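/- Theorem. Let $(Q,g)$ be a smooth $n$-dimensional Riemannian manifold and let $\tilde\nabla$ be a smooth affine connection on $Q$ that is compatible with $g$, with torsion $\tilde T(X,Y)=\tilde\nabla_XY-\tilde\nabla_YX-[X,Y]$. Let $\operatorname{tr}\tilde T$ be the 1-form on $Q$ given by $(\operatorname{tr}\tilde T)(v)=\operatorname{tr}\bigl(w\mapsto \tilde T(v,w)\bigr)$. In local coordinates $(x^i)$ of $Q$ and the induced coordinates $(x^i,v^i)$ of $TQ$, write $\tilde\nabla_{\partial_j}\partial_k=\Gamma^i_{jk}\partial_i$, and let $$X=v^i\frac{\partial}{\partial x^i}-\Gamma^i_{jk}v^jv^k\frac{\partial}{\partial v^i},\qquad \Omega=\det(g_{ij})\,dx^1\wedge\dots\wedge dx^n\wedge dv^1\wedge\dots\wedge dv^n$$ be the geodesic spray of $\tilde\nabla$ and the associated volume form on $TQ$ (both are globally defined and smooth). For a volume form $\mu$ on $TQ$, the divergence $\operatorname{div}_\mu(X)$ is the function with $\mathcal L_X\mu=\operatorname{div}_\mu(X)\,\mu$. Then: 1. $\operatorname{div}_\Omega(X)(q,v)=(\operatorname{tr}\tilde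 T)_q(v)$ for all $(q,v)\in TQ$. 2. There is a smooth function $f:Q\to(0,\infty)$ such that the volume form $(\pi_Q^*f)\,\Omega$ is invariant under the geodesic spray, i.e. $\operatorname{div}_{(\pi_Q^*f)\Omega}(X)=0$, where $\pi_Q:TQ\to Q$ is the projection, if and only if $\operatorname{tr}\tilde T$ is exact, i.e. $\operatorname{tr}\tilde T=dh$ for some smooth function $h:Q\to\mathbb R$. -/

import Mathlib

open Bundle
open scoped Manifold ContDiff

noncomputable section

/-! ### Volume forms and divergence on a smooth manifold -/

section Divergence

variable {F : Type*} [NormedAddCommGroup F] [NormedSpace ℝ F]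
  {H : Type*} [TopologicalSpace H] (J : ModelWithCorners ℝ F H)
  {M : Type*} [TopologicalSpace M] [ChartedSpace H M] [IsManifold J 1 M]
  {ι : Type*}

/-- A field of alternating `ι`-forms is smooth if it takes smooth values on smooth vector fields. -/
def IsSmoothForm (Ω : ∀ p : M, (TangentSpace J p) [⋀^ι]→ₗ[ℝ] ℝ) : Prop :=
  ∀ (p : M) (Y : ι → ∀ q : M, TangentSpace J q),
    (∀ i, ContMDiffAt J J.tangent ∞ (fun q ↦ (⟨q, Y i q⟩ : TangentBundle J M)) p) →
    ContMDiffAt J 𝓘(ℝ, ℝ) ∞ (fun q ↦ Ω q (fun i ↦ Y i q)) p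

/-- The Lie derivative `𝓛_X Ω` of an alternating form along `X`, evaluated on vector fields `Yᵢ`:
`(𝓛_X Ω)(Y₁, …, Yₘ) = X (Ω(Y₁, …, Yₘ)) - ∑ᵢ Ω(Y₁, …, [X, Yᵢ], …, Yₘ)`. -/
def lieDerivativeForm [Fintype ι] [DecidableEq ι]
    (X : ∀ p : M, TangentSpace J p) (Ω : ∀ p : M, (TangentSpace J p) [⋀^ι]→ₗ[ℝ] ℝ)
    (Y : ι → ∀ p : M, TangentSpace J p) (p : M) : ℝ :=
  mvfderiv J (fun q ↦ Ω q (fun i ↦ Y i q)) p (X p) -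
    ∑ i, Ω p (Function.update (fun j ↦ Y j p) i (VectorField.mlieBracket J X (Y i) p))

/-- `HasDivergence J Ω X δ`: `Ω` is a smooth nowhere vanishing alternating form, `X` is a smooth
vector field and `𝓛_X Ω = δ Ω`. It is meant for forms of top degree, i.e. volume forms, and then
says that `δ` is the divergence of `X` with respect to `Ω`. -/
structure HasDivergence [Fintype ι] [DecidableEq ι]
    (Ω : ∀ p : M, (TangentSpace J p) [⋀^ι]→ₗ[ℝ] ℝ)
    (X : ∀ p : M, TangentSpace J p) (δ : M → ℝ) : Prop where
  smooth_form : IsSmoothForm J Ω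
  form_ne_zero : ∀ p, Ω p ≠ 0
  smooth_field : ContMDiff J J.tangent ∞ (fun p ↦ (⟨p, X p⟩ : TangentBundle J M))
  lieDerivative_eq : ∀ (p : M) (Y : ι → ∀ q : M, TangentSpace J q),
    (∀ i, MDifferentiableAt J J.tangent (fun q ↦ (⟨q, Y i q⟩ : TangentBundle J M)) p) →
    lieDerivativeForm J X Ω Y p = δ p * Ω p (fun i ↦ Y i p)

end Divergence

section TangentBundle

variable {n : ℕ} {Q : Type*} [TopologicalSpace Q] [ChartedSpace (EuclideanSpace ℝ (Fin n)) Q]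
  [IsManifold (𝓡 n) ∞ Q]

variable (n) in
/-- The standard basis of the model space `ℝⁿ`. -/
def stdBasis : Module.Basis (Fin n) ℝ (EuclideanSpace ℝ (Fin n)) :=
  (EuclideanSpace.basisFun (Fin n) ℝ).toBasis

/-! ### Coordinates on the configuration space -/

/-- The coordinate vector field `∂/∂xⁱ` of the preferred chart `(x¹, …, xⁿ)` at `q₀`
(extended by zero outside of the domain of that chart). -/
def coordField (q₀ : Q) (i : Fin n) : ∀ q : Q, TangentSpace (𝓡 n) q :=
  (trivializationAt (EuclideanSpace ℝ (Fin n)) (TangentSpace (𝓡 n)) q₀).localFrame (stdBasis n) i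

/-- The basis `∂/∂x¹, …, ∂/∂xⁿ` of the tangent space at `q`, for the preferred chart at `q`. -/
def coordBasis (q : Q) : Module.Basis (Fin n) ℝ (TangentSpace (𝓡 n) q) :=
  (trivializationAt (EuclideanSpace ℝ (Fin n)) (TangentSpace (𝓡 n)) q).basisAt (stdBasis n)
    (FiberBundle.mem_baseSet_trivializationAt' q)

/-- The determinant of `gᵢⱼ = g(∂/∂xⁱ, ∂/∂xʲ)` at `q`, in the preferred chart at `q`. -/
def metricDet [RiemannianBundle (fun q : Q ↦ TangentSpace (𝓡 n) q)] (q : Q) : ℝ :=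
  (Matrix.of fun i j : Fin n ↦ inner ℝ (coordBasis q i) (coordBasis q j)).det

/-- The Christoffel symbol `Γⁱⱼₖ` at `q`, in the preferred chart at `q`: the `i`-th coordinate of
`∇_{∂/∂xʲ} ∂/∂xᵏ`. -/
def christoffel
    (cov : CovariantDerivative (𝓡 n) (EuclideanSpace ℝ (Fin n)) (TangentSpace (𝓡 n) : Q → Type _))
    (q : Q) (i j k : Fin n) : ℝ :=
  (coordBasis q).repr (cov (coordField q k) q (coordField q j q)) i

/-! ### The tangent bundle: natural coordinates, geodesic spray, volume form -/

/-- The basis `∂/∂x¹, …, ∂/∂xⁿ, ∂/∂v¹, …, ∂/∂vⁿ` of `T_p(TQ)`, for the natural chart `(x, v)` of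
`TQ` induced by the preferred chart `x` of `Q` at the base point of `p`. The index `Sum.inl i`
stands for `∂/∂xⁱ` and the index `Sum.inr i` for `∂/∂vⁱ`. -/
def natBasis (p : TangentBundle (𝓡 n) Q) :
    Module.Basis (Fin n ⊕ Fin n) ℝ (TangentSpace (𝓡 n).tangent p) :=
  (trivializationAt (EuclideanSpace ℝ (Fin n) × EuclideanSpace ℝ (Fin n))
    (TangentSpace (𝓡 n).tangent) p).basisAt ((stdBasis n).prod (stdBasis n))
    (FiberBundle.mem_baseSet_trivializationAt' p)

/-- The geodesic spray `vⁱ ∂/∂xⁱ - Γⁱⱼₖ vʲ vᵏ ∂/∂vⁱ` of an affine connection, a vector field on the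
tangent bundle. -/
def geodesicSpray
    (cov : CovariantDerivative (𝓡 n) (EuclideanSpace ℝ (Fin n)) (TangentSpace (𝓡 n) : Q → Type _))
    (p : TangentBundle (𝓡 n) Q) : TangentSpace (𝓡 n).tangent p :=
  let v : Fin n → ℝ := fun i ↦ (coordBasis p.proj).repr p.snd i
  ∑ i, v i • natBasis p (Sum.inl i) -
    ∑ i, (∑ j, ∑ k, christoffel cov p.proj i j k * v j * v k) • natBasis p (Sum.inr i)

/-- The volume form `det g · dx¹ ∧ ⋯ ∧ dxⁿ ∧ dv¹ ∧ ⋯ ∧ dvⁿ` on the tangent bundle. -/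
def metricVolume [RiemannianBundle (fun q : Q ↦ TangentSpace (𝓡 n) q)]
    (p : TangentBundle (𝓡 n) Q) :
    (TangentSpace (𝓡 n).tangent p) [⋀^(Fin n ⊕ Fin n)]→ₗ[ℝ] ℝ :=
  metricDet (n := n) p.proj • (natBasis p).det

/-! ### The trace of the torsion, exactness, invariant volumes -/

/-- The trace of the torsion of an affine connection, as a 1-form:
`(tr T)(v) = tr (w ↦ T(v, w))`, i.e. `tr T = (Γⁱₖᵢ - Γⁱᵢₖ) dxᵏ`. -/
def torsionTrace
    (cov : CovariantDerivative (𝓡 n) (EuclideanSpace ℝ (Fin n)) (TangentSpace (𝓡 n) : Q → Type _))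
    (q : Q) (v : TangentSpace (𝓡 n) q) : ℝ :=
  LinearMap.trace ℝ (TangentSpace (𝓡 n) q) (cov.torsion q v).toLinearMap

/-- The 1-form `α` on `Q` is exact: `α = dh` for some smooth function `h`. -/
def IsExactOneForm (α : ∀ q : Q, TangentSpace (𝓡 n) q → ℝ) : Prop :=
  ∃ h : Q → ℝ, ContMDiff (𝓡 n) 𝓘(ℝ, ℝ) ∞ h ∧
    ∀ (q : Q) (v : TangentSpace (𝓡 n) q), α q v = mvfderiv (𝓡 n) h q v

/-- `f · (det g · dx ∧ dv)`, with the density `f` a function on `Q` pulled back to `TQ`, is a volume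
form invariant under the geodesic spray: the density is smooth and positive, and the divergence of
the spray with respect to the volume form vanishes. -/
def IsInvariantDensity [RiemannianBundle (fun q : Q ↦ TangentSpace (𝓡 n) q)]
    (cov : CovariantDerivative (𝓡 n) (EuclideanSpace ℝ (Fin n)) (TangentSpace (𝓡 n) : Q → Type _))
    (f : Q → ℝ) : Prop :=
  ContMDiff (𝓡 n) 𝓘(ℝ, ℝ) ∞ f ∧ (∀ q, 0 < f q) ∧
    HasDivergence (𝓡 n).tangent (fun p : TangentBundle (𝓡 n) Q ↦ f p.proj • metricVolume p)
      (geodesicSpray cov) 0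

end TangentBundle

end

set_option synthInstance.maxHeartbeats 400000

/-! In natural coordinates the spray is `(v, -Γ(v,v))` and the volume form is `det g` times a
constant determinant. For `ρ · det` the divergence of `X` is `X(ρ)/ρ + tr DX`. The first component
`v` does not depend on `x`, so it adds nothing to the trace, and the vertical block gives `-(Γⁱⱼᵢ +
Γⁱᵢⱼ) vʲ`. Metric compatibility and Jacobi's formula give `X(det g) = 2 Γⁱⱼᵢ vʲ det g`. The sum is
`(Γⁱⱼᵢ - Γⁱᵢⱼ) vʲ`, the trace of the torsion. A density `f` adds `df(v)/f`, so invariance means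
`d(-log f) = tr T`; hence `h = -log f` and `f = exp(-h)` correspond to each other.

The definitions use at each point `p` the chart preferred at `p`, which varies with `p`, so nothing
can be differentiated before it is rewritten in one fixed chart. For the volume form
(`metricVolume_apply`) the change of natural coordinates is block triangular with both diagonal
blocks equal to the Jacobian `C`; its determinant `(det C)²` cancels against the change of `det g`.
For the spray (`tangentCoord_geodesicSpray`) the inhomogeneous term in the transformation of `Γ`
cancels the second derivatives of the chart change.

The computation is carried by `lieDerivativeForm_eq`, `exists_mvfderiv_geodesicSpray`,
`mvfderiv_metricMatrix_det` and `torsionTrace_eq`, and assembled in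
`hasDivergence_smul_metricVolume`. -/

/-! ### The derivative of the determinant -/

-- By Cramer's rule the `i`-th summand is the `i`-th diagonal entry of `adj(M) N M`, and the trace
-- is cyclic.
open Matrix in
theorem Matrix.sum_det_updateCol_mul {R ι : Type*} [CommRing R] [Fintype ι] [DecidableEq ι]
    (M N : Matrix ι ι R) :
    ∑ i, (M.updateCol i ((N * M).col i)).det = N.trace * M.det := by
  have h (i : ι) : (M.updateCol i ((N * M).col i)).det = (M.adjugate * (N * M)) i i := by
    rw [← cramer_apply, cramer_eq_adjugate_mulVec]
    simp [Matrix.mulVec, dotProduct, Matrix.mul_apply, Matrix.col]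
  simp_rw [h]
  change trace _ = _
  rw [← Matrix.mul_assoc, trace_mul_comm, ← Matrix.mul_assoc, mul_adjugate]
  simp [mul_comm]

namespace Module.Basis

/-- The infinitesimal form of `det (AY) = det A · det Y`; this is how a trace enters the divergence.
-/
theorem sum_det_update {R V ι : Type*} [CommRing R] [AddCommGroup V] [Module R V]
    [Fintype ι] [DecidableEq ι] (b : Module.Basis ι R V) (A : V →ₗ[R] V) (Y : ι → V) :
    ∑ i, b.det (Function.update Y i (A (Y i))) = LinearMap.trace R V A * b.det Y := by
  have key (i : ι) : b.repr (A (Y i)) = (LinearMap.toMatrix b b A * b.toMatrix Y).col i := by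
    rw [← LinearMap.toMatrix_mulVec_repr b b]
    ext j
    simp [Matrix.mulVec, dotProduct, Matrix.mul_apply, Module.Basis.toMatrix_apply]
  simp_rw [b.det_apply, LinearMap.trace_eq_matrix_trace R b A, b.toMatrix_update, key,
    Matrix.sum_det_updateCol_mul]

theorem det_map_linearMap {R V W ι : Type*} [CommRing R] [AddCommGroup V] [Module R V]
    [AddCommGroup W] [Module R W]
    [Fintype ι] [DecidableEq ι] (b : Module.Basis ι R V) (c : Module.Basis ι R W) (A : V →ₗ[R] W)
    (Y : ι → V) :
    c.det (fun i ↦ A (Y i)) = (LinearMap.toMatrix b c A).det * b.det Y := by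
  rw [det_apply, det_apply, ← Matrix.det_mul]
  congr 1
  ext i j
  rw [toMatrix_apply, ← LinearMap.toMatrix_mulVec_repr b c]
  simp [Matrix.mulVec, dotProduct, Matrix.mul_apply, Module.Basis.toMatrix_apply]

variable {F ι : Type*} [NormedAddCommGroup F] [NormedSpace ℝ F] [FiniteDimensional ℝ F]
  [Fintype ι] [DecidableEq ι] (b : Module.Basis ι ℝ F)

/-- The determinant in a basis of a finite dimensional normed space, as a continuous map. -/
noncomputable def continuousDet : F [⋀^ι]→L[ℝ] ℝ :=
  { b.det with
    cont := by
      change Continuous fun Y : ι → F ↦ (b.toMatrix Y).det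
      refine Continuous.matrix_det (continuous_matrix fun i j ↦ ?_)
      exact (b.coord i).continuous_of_finiteDimensional.comp (continuous_apply j) }

theorem contDiff_det {n : ℕ∞ω} : ContDiff ℝ n (fun Y : ι → F ↦ b.det Y) :=
  b.continuousDet.toContinuousMultilinearMap.contDiff

end Module.Basis

/-! ### Derivatives of vector-valued functions on a manifold -/

section VectorValued

variable {E : Type*} [NormedAddCommGroup E] [NormedSpace ℝ E] {H : Type*} [TopologicalSpace H]
  {I : ModelWithCorners ℝ E H} {M : Type*} [TopologicalSpace M] [ChartedSpace H M]
  {F : Type*} [NormedAddCommGroup F] [NormedSpace ℝ F]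
  {G : Type*} [NormedAddCommGroup G] [NormedSpace ℝ G]

theorem HasMFDerivAt.mvfderiv_eq {f : M → F} {p : M} {f' : TangentSpace I p →L[ℝ] F}
    (h : HasMFDerivAt I 𝓘(ℝ, F) f p f') : mvfderiv I f p = f' := by
  convert! h.mfderiv

theorem MDifferentiableAt.hasMFDerivAt_mvfderiv {f : M → F} {p : M}
    (h : MDifferentiableAt I 𝓘(ℝ, F) f p) : HasMFDerivAt I 𝓘(ℝ, F) f p (mvfderiv I f p) := by
  convert! h.hasMFDerivAt

theorem HasFDerivAt.comp_hasMFDerivAt {g : F → G} {f : M → F} {p : M} {g' : F →L[ℝ] G}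
    {f' : TangentSpace I p →L[ℝ] F} (hg : HasFDerivAt g g' (f p))
    (hf : HasMFDerivAt I 𝓘(ℝ, F) f p f') :
    HasMFDerivAt I 𝓘(ℝ, G) (fun q ↦ g (f q)) p (g'.comp f') :=
  hg.hasMFDerivAt.comp p hf

theorem hasMFDerivAt_pi {ι : Type*} [Fintype ι] {Y : ι → M → F} {p : M}
    {Y' : ι → TangentSpace I p →L[ℝ] F} (hY : ∀ i, HasMFDerivAt I 𝓘(ℝ, F) (Y i) p (Y' i)) :
    HasMFDerivAt I 𝓘(ℝ, ι → F) (fun q i ↦ Y i q) p (ContinuousLinearMap.pi Y') :=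
  ⟨continuousAt_pi.2 fun i ↦ (hY i).1, hasFDerivWithinAt_pi.2 fun i ↦ (hY i).2⟩

theorem Filter.EventuallyEq.mvfderiv_eq {f g : M → F} {p : M} (h : f =ᶠ[nhds p] g) :
    mvfderiv I f p = mvfderiv I g p := by
  have := h.mfderiv_eq (I := I) (I' := 𝓘(ℝ, F))
  ext v
  exact DFunLike.congr_fun this v

theorem Module.Basis.hasMFDerivAt_det {ι : Type*} [FiniteDimensional ℝ F]
    [Fintype ι] [DecidableEq ι] (b : Module.Basis ι ℝ F) {Y : ι → M → F} {p : M}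
    {Y' : ι → TangentSpace I p →L[ℝ] F} (hY : ∀ i, HasMFDerivAt I 𝓘(ℝ, F) (Y i) p (Y' i)) :
    ∃ D : TangentSpace I p →L[ℝ] ℝ,
      HasMFDerivAt I 𝓘(ℝ, ℝ) (fun q ↦ b.det (fun i ↦ Y i q)) p D ∧
      ∀ v, D v = ∑ i, b.det (Function.update (fun j ↦ Y j p) i (Y' i v)) := by
  refine ⟨_, (b.continuousDet.hasFDerivAt (fun i ↦ Y i p)).comp_hasMFDerivAt (hasMFDerivAt_pi hY),
    fun v ↦ ?_⟩
  exact b.continuousDet.toContinuousMultilinearMap.linearDeriv_apply _ _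

end VectorValued

/-! ### Tangent coordinates, Lie brackets and divergence in a fixed chart -/

section TangentCoordinates

variable {F : Type*} [NormedAddCommGroup F] [NormedSpace ℝ F]
  {H : Type*} [TopologicalSpace H] {J : ModelWithCorners ℝ F H}
  {M : Type*} [TopologicalSpace M] [ChartedSpace H M] [IsManifold J 1 M]

/-- The coordinates of a tangent vector at `p` in the preferred chart at `p₀`. -/
noncomputable def tangentCoord (p₀ p : M) : TangentSpace J p →L[ℝ] F :=
  (trivializationAt F (TangentSpace J) p₀).continuousLinearMapAt ℝ p

variable (J) in
theorem tangentCoord_self (p : M) :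
    tangentCoord (J := J) p p = ContinuousLinearMap.id ℝ F := by
  rw [tangentCoord, TangentBundle.continuousLinearMapAt_trivializationAt (mem_chart_source H p)]
  exact mfderiv_extChartAt_self

theorem tangentCoord_eq_mfderiv {p₀ p : M} (hp : p ∈ (chartAt H p₀).source) :
    tangentCoord (J := J) p₀ p = mfderiv J 𝓘(ℝ, F) (extChartAt J p₀) p :=
  TangentBundle.continuousLinearMapAt_trivializationAt hp

theorem trivializationAt_snd {p₀ p : M} (hp : p ∈ (chartAt H p₀).source) (v : TangentSpace J p) :
    (trivializationAt F (TangentSpace J) p₀ ⟨p, v⟩).2 = tangentCoord p₀ p v := by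
  rw [tangentCoord, Trivialization.continuousLinearMapAt_apply,
    Trivialization.coe_linearMapAt_of_mem]
  simpa using hp

theorem mpullbackWithin_extChartAt_symm_apply {p₀ : M} (X : ∀ p : M, TangentSpace J p) {y : F}
    (hy : y ∈ (extChartAt J p₀).target) :
    VectorField.mpullbackWithin 𝓘(ℝ, F) J (extChartAt J p₀).symm X (Set.range J) y =
      tangentCoord p₀ ((extChartAt J p₀).symm y) (X ((extChartAt J p₀).symm y)) := by
  have hs : (extChartAt J p₀).symm y ∈ (chartAt H p₀).source := by
    simpa using (extChartAt J p₀).map_target hy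
  rw [VectorField.mpullbackWithin_apply, tangentCoord_eq_mfderiv hs]
  have h := ContinuousLinearMap.inverse_eq
    (mfderivWithin_extChartAt_symm_comp_mfderiv_extChartAt hy)
    (mfderiv_extChartAt_comp_mfderivWithin_extChartAt_symm hy)
  exact DFunLike.congr_fun h _

theorem mpullbackWithin_extChartAt_symm_eventuallyEq {p₀ : M} (X : ∀ p : M, TangentSpace J p) :
    VectorField.mpullbackWithin 𝓘(ℝ, F) J (extChartAt J p₀).symm X (Set.range J)
      =ᶠ[nhdsWithin (extChartAt J p₀ p₀) (Set.range J)]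
    writtenInExtChartAt J 𝓘(ℝ, F) p₀ (fun p ↦ tangentCoord p₀ p (X p)) :=
  Filter.eventuallyEq_of_mem (extChartAt_target_mem_nhdsWithin p₀)
    fun _ ↦ mpullbackWithin_extChartAt_symm_apply X

theorem MDifferentiableAt.tangentCoord {p₀ : M} {X : ∀ p : M, TangentSpace J p}
    (hX : MDifferentiableAt J J.tangent (fun q ↦ (⟨q, X q⟩ : TangentBundle J M)) p₀) :
    MDifferentiableAt J 𝓘(ℝ, F) (fun p ↦ tangentCoord p₀ p (X p)) p₀ := by
  refine ((mdifferentiableAt_totalSpace (F := F) (E := TangentSpace J) ..).1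
    hX).2.congr_of_eventuallyEq ?_
  filter_upwards [(chartAt H p₀).open_source.mem_nhds (mem_chart_source H p₀)] with p hp
  exact (trivializationAt_snd hp _).symm

theorem contMDiffAt_tangentCoord_iff {p₀ : M} {X : ∀ p : M, TangentSpace J p} {n : ℕ∞ω} :
    ContMDiffAt J J.tangent n (fun q ↦ (⟨q, X q⟩ : TangentBundle J M)) p₀ ↔
    ContMDiffAt J 𝓘(ℝ, F) n (fun p ↦ tangentCoord p₀ p (X p)) p₀ := by
  rw [contMDiffAt_section]
  refine Filter.EventuallyEq.contMDiffAt_iff ?_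
  filter_upwards [(chartAt H p₀).open_source.mem_nhds (mem_chart_source H p₀)] with p hp
  exact (trivializationAt_snd hp _)

/-- The Lie bracket of two vector fields, in the coordinates given by a chart. -/
theorem tangentCoord_mlieBracket {p₀ : M} {X Y : ∀ p : M, TangentSpace J p}
    (hX : MDifferentiableAt J J.tangent (fun q ↦ (⟨q, X q⟩ : TangentBundle J M)) p₀)
    (hY : MDifferentiableAt J J.tangent (fun q ↦ (⟨q, Y q⟩ : TangentBundle J M)) p₀) :
    tangentCoord p₀ p₀ (VectorField.mlieBracket J X Y p₀) =
      mvfderiv J (fun p ↦ tangentCoord p₀ p (Y p)) p₀ (X p₀) -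
        mvfderiv J (fun p ↦ tangentCoord p₀ p (X p)) p₀ (Y p₀) := by
  have hd (Z : ∀ p : M, TangentSpace J p) :=
    (mpullbackWithin_extChartAt_symm_eventuallyEq (p₀ := p₀) Z).fderivWithin_eq (𝕜 := ℝ)
      (mpullbackWithin_extChartAt_symm_apply Z (mem_extChartAt_target (I := J) p₀))
  have hv (Z : ∀ p : M, TangentSpace J p) : VectorField.mpullbackWithin 𝓘(ℝ, F) J
      (extChartAt J p₀).symm Z (Set.range J) (extChartAt J p₀ p₀) = Z p₀ := by
    rw [mpullbackWithin_extChartAt_symm_apply Z (mem_extChartAt_target (I := J) p₀)]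
    -- The point is generalised because the chart inverse returns `p₀` only up to a propositional
    -- equality, on which the tangent space depends.
    have (p : M) (hp : p = p₀) : tangentCoord p₀ p (Z p) = Z p₀ := by
      subst hp
      rw [tangentCoord_self]
      rfl
    exact this _ (extChartAt_to_inv p₀)
  rw [← VectorField.mlieBracketWithin_univ, VectorField.mlieBracketWithin_apply,
    hX.tangentCoord.mvfderiv, hY.tangentCoord.mvfderiv, mfderiv_extChartAt_self,
    tangentCoord_self, ← hd X, ← hd Y, ← hv X, ← hv Y]
  simp only [Set.preimage_univ, Set.univ_inter, VectorField.lieBracketWithin]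
  erw [ContinuousLinearMap.inverse_id]
  rfl

variable {ι : Type*} [Fintype ι] [DecidableEq ι]

/-- In coordinates `[X, Yᵢ] = DYᵢ(X) - DX(Yᵢ)`. The terms `DYᵢ(X)` cancel against the derivative of
`det(Y)`, and the terms `DX(Yᵢ)` sum to the trace of `A = DX`. -/
theorem lieDerivativeForm_eq [FiniteDimensional ℝ F] (b : Module.Basis ι ℝ F)
    {Ω : ∀ p : M, (TangentSpace J p) [⋀^ι]→ₗ[ℝ] ℝ} {X : ∀ p : M, TangentSpace J p} {ρ : M → ℝ}
    {p₀ : M} (hΩ : ∀ᶠ p in nhds p₀, ∀ Y, Ω p Y = ρ p * b.det (fun i ↦ tangentCoord p₀ p (Y i)))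
    (hρ : MDifferentiableAt J 𝓘(ℝ, ℝ) ρ p₀)
    (hX : MDifferentiableAt J J.tangent (fun q ↦ (⟨q, X q⟩ : TangentBundle J M)) p₀)
    {Y : ι → ∀ p : M, TangentSpace J p}
    (hY : ∀ i, MDifferentiableAt J J.tangent (fun q ↦ (⟨q, Y i q⟩ : TangentBundle J M)) p₀)
    {A : F →ₗ[ℝ] F} (hA : ∀ v : TangentSpace J p₀,
      A (tangentCoord p₀ p₀ v) = mvfderiv J (fun p ↦ tangentCoord p₀ p (X p)) p₀ v) :
    lieDerivativeForm J X Ω Y p₀ =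
      (mvfderiv J ρ p₀ (X p₀) + ρ p₀ * LinearMap.trace ℝ F A) *
        b.det (fun i ↦ tangentCoord p₀ p₀ (Y i p₀)) := by
  have hΩ₀ := hΩ.self_of_nhds
  obtain ⟨D, hD, hDv⟩ := b.hasMFDerivAt_det fun i ↦ (hY i).tangentCoord.hasMFDerivAt_mvfderiv
  have h1 : (fun q ↦ Ω q (fun i ↦ Y i q)) =ᶠ[nhds p₀]
      fun q ↦ ρ q * b.det (fun i ↦ tangentCoord p₀ q (Y i q)) :=
    hΩ.mono fun p hp ↦ hp _
  have hu (i : ι) (w : TangentSpace J p₀) :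
      (fun j ↦ tangentCoord p₀ p₀ (Function.update (fun j ↦ Y j p₀) i w j)) =
        Function.update (fun j ↦ tangentCoord p₀ p₀ (Y j p₀)) i (tangentCoord p₀ p₀ w) := by
    ext1 j
    exact Function.apply_update (fun _ ↦ tangentCoord p₀ p₀) (fun j ↦ Y j p₀) i w j
  rw [lieDerivativeForm, h1.mvfderiv_eq, mvfderiv_fun_mul hρ hD.mdifferentiableAt, hD.mvfderiv_eq]
  simp only [hΩ₀, hu, tangentCoord_mlieBracket hX (hY _), ← hA, AlternatingMap.map_update_sub,
    ← Finset.mul_sum, Finset.sum_sub_distrib,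
    b.sum_det_update A (fun j ↦ tangentCoord p₀ p₀ (Y j p₀)), add_apply,
    smul_apply, hDv, smul_eq_mul]
  ring

/-- Each point is treated in its own chart, so the coordinate density `ρ p₀` and the derivative `A
p₀` are indexed by the centre `p₀`. -/
theorem hasDivergence_of_coord [FiniteDimensional ℝ F] (b : Module.Basis ι ℝ F)
    {Ω : ∀ p : M, (TangentSpace J p) [⋀^ι]→ₗ[ℝ] ℝ} {X : ∀ p : M, TangentSpace J p} {ρ : M → M → ℝ}
    (hΩ : ∀ p₀, ∀ᶠ p in nhds p₀, ∀ Y,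
      Ω p Y = ρ p₀ p * b.det (fun i ↦ tangentCoord p₀ p (Y i)))
    (hρ : ∀ p₀, ContMDiffAt J 𝓘(ℝ, ℝ) ∞ (ρ p₀) p₀) (hρ₀ : ∀ p, ρ p p ≠ 0)
    (hX : ContMDiff J J.tangent ∞ (fun q ↦ (⟨q, X q⟩ : TangentBundle J M)))
    {A : M → F →ₗ[ℝ] F} (hA : ∀ (p₀ : M) (v : TangentSpace J p₀),
      A p₀ (tangentCoord p₀ p₀ v) = mvfderiv J (fun p ↦ tangentCoord p₀ p (X p)) p₀ v)
    {δ : M → ℝ}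
    (hδ : ∀ p, δ p * ρ p p = mvfderiv J (ρ p) p (X p) + ρ p p * LinearMap.trace ℝ F (A p)) :
    HasDivergence J Ω X δ where
  smooth_form p₀ Y hY := by
    refine ContMDiffAt.congr_of_eventuallyEq ?_ ((hΩ p₀).mono fun p hp ↦ hp _)
    refine (hρ p₀).mul ?_
    have h : ContMDiffAt J 𝓘(ℝ, ι → F) ∞ (fun p i ↦ tangentCoord p₀ p (Y i p)) p₀ :=
      contMDiffAt_pi_space.2 fun i ↦ contMDiffAt_tangentCoord_iff.1 (hY i)
    exact b.contDiff_det.contMDiff.contMDiffAt.comp p₀ h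
  form_ne_zero p h := by
    have h1 := (hΩ p).self_of_nhds (fun i ↦ (b i : F))
    rw [h, tangentCoord_self] at h1
    have h2 : b.det (fun i ↦ b i) = 1 := b.det_self
    refine hρ₀ p ?_
    rw [← mul_one (ρ p p), ← h2]
    exact h1.symm
  smooth_field := hX
  lieDerivative_eq p Y hY := by
    rw [lieDerivativeForm_eq b (hΩ p) ((hρ p).mdifferentiableAt (by simp))
      ((hX p).mdifferentiableAt (by simp)) hY (hA p), ← hδ, (hΩ p).self_of_nhds]
    ring

/-- Vectors on which the form is nonzero at `p` extend to vector fields differentiable at `p`;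
evaluating there allows division. -/
theorem HasDivergence.unique {Ω : ∀ p : M, (TangentSpace J p) [⋀^ι]→ₗ[ℝ] ℝ}
    [FiniteDimensional ℝ F] [IsManifold J 2 M]
    {X : ∀ p : M, TangentSpace J p} {δ δ' : M → ℝ} (h : HasDivergence J Ω X δ)
    (h' : HasDivergence J Ω X δ') (p : M) : δ p = δ' p := by
  have : ∃ v, Ω p v ≠ 0 := by
    by_contra! hv
    exact h.form_ne_zero p (AlternatingMap.ext hv)
  obtain ⟨v, hv⟩ := this
  have hY (i : ι) := FiberBundle.mdifferentiableAt_extend J F (v i)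
  have e := h.lieDerivative_eq p (fun i ↦ FiberBundle.extend F (v i)) hY
  rw [h'.lieDerivative_eq p (fun i ↦ FiberBundle.extend F (v i)) hY] at e
  simp only [FiberBundle.extend_apply_self] at e
  exact (mul_right_cancel₀ hv e).symm

end TangentCoordinates

/-! ### Natural coordinates on the tangent bundle -/

section TangentBundleCoordinates

variable {E : Type*} [NormedAddCommGroup E] [NormedSpace ℝ E]
  {H : Type*} [TopologicalSpace H] {I : ModelWithCorners ℝ E H}
  {M : Type*} [TopologicalSpace M] [ChartedSpace H M] [IsManifold I ∞ M]

/-- The fiber coordinates `v` in the natural chart `(x, v)` of the tangent bundle induced by the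
preferred chart at `q₀`. -/
noncomputable def fiberCoord (q₀ : M) (p : TangentBundle I M) : E :=
  tangentCoord q₀ p.proj p.snd

theorem contMDiffAt_fiberCoord {q₀ : M} {p : TangentBundle I M}
    (hp : p.proj ∈ (chartAt H q₀).source) :
    ContMDiffAt I.tangent 𝓘(ℝ, E) ∞ (fiberCoord q₀) p := by
  have h := (Trivialization.contMDiffAt_iff (IB := I) (IM := I.tangent) (n := ∞)
    (e := trivializationAt E (TangentSpace I) q₀)
    (f := fun p : TangentBundle I M ↦ p) (x₀ := p) (by simpa using hp)).1 contMDiffAt_id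
  refine h.2.congr_of_eventuallyEq ?_
  filter_upwards [((chartAt H q₀).open_source.preimage
    (FiberBundle.continuous_proj E (TangentSpace I))).mem_nhds hp] with p' hp'
  exact (trivializationAt_snd hp' _).symm

theorem hasMFDerivAt_fiberCoord {q₀ : M} {p : TangentBundle I M}
    (hp : p.proj ∈ (chartAt H q₀).source) :
    HasMFDerivAt I.tangent 𝓘(ℝ, E) (fiberCoord q₀) p (mvfderiv I.tangent (fiberCoord q₀) p) :=
  ((contMDiffAt_fiberCoord hp).mdifferentiableAt (by simp)).hasMFDerivAt_mvfderiv

/-- The natural chart is `(x ∘ π, v)`; its differential is computed componentwise. -/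
theorem tangentCoord_tangentBundle {p₀ p : TangentBundle I M}
    (hp : p.proj ∈ (chartAt H p₀.proj).source) (ξ : TangentSpace I.tangent p) :
    tangentCoord p₀ p ξ =
      (tangentCoord p₀.proj p.proj
          (mfderiv I.tangent I (TotalSpace.proj : TangentBundle I M → M) p ξ),
        mvfderiv I.tangent (fiberCoord p₀.proj) p ξ) := by
  have hc : p ∈ (chartAt (ModelProd H E) p₀).source := by simpa using hp
  have hπ : HasMFDerivAt I.tangent I (TotalSpace.proj : TangentBundle I M → M) p _ :=
    ((contMDiff_proj (TangentSpace I)).contMDiffAt.mdifferentiableAt (n := ∞)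
      (by simp)).hasMFDerivAt
  have h1 : HasMFDerivAt I 𝓘(ℝ, E) (extChartAt I p₀.proj) p.proj (tangentCoord p₀.proj p.proj) := by
    rw [tangentCoord_eq_mfderiv hp]
    exact (mdifferentiableAt_extChartAt hp).hasMFDerivAt
  have h2 : HasMFDerivAt I.tangent 𝓘(ℝ, E × E)
      (fun p ↦ (extChartAt I p₀.proj p.proj, fiberCoord p₀.proj p)) p
      (((tangentCoord p₀.proj p.proj).comp (mfderiv I.tangent I TotalSpace.proj p)).prod
        (mvfderiv I.tangent (fiberCoord p₀.proj) p)) :=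
    ⟨(h1.comp p hπ).1.prodMk (hasMFDerivAt_fiberCoord hp).1,
      (h1.comp p hπ).2.prodMk (hasMFDerivAt_fiberCoord hp).2⟩
  have h3 : extChartAt I.tangent p₀ =ᶠ[nhds p]
      fun p ↦ (extChartAt I p₀.proj p.proj, fiberCoord p₀.proj p) := by
    filter_upwards [((chartAt H p₀.proj).open_source.preimage
      (FiberBundle.continuous_proj E (TangentSpace I))).mem_nhds hp] with p' hp'
    rw [FiberBundle.extChartAt, fiberCoord, ← trivializationAt_snd hp']
    rfl
  rw [tangentCoord_eq_mfderiv hc, h3.mfderiv_eq]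
  exact DFunLike.congr_fun h2.mfderiv ξ

end TangentBundleCoordinates

/-! ### Change of chart on the base and on the tangent bundle -/

section FrameChange

variable {E : Type*} [NormedAddCommGroup E] [NormedSpace ℝ E]
  {H : Type*} [TopologicalSpace H] {I : ModelWithCorners ℝ E H}
  {M : Type*} [TopologicalSpace M] [ChartedSpace H M] [IsManifold I ∞ M]

/-- The tangent vector at `q` with given coordinates in the preferred chart at `q₀`. -/
noncomputable def tangentOfCoord (q₀ q : M) : E →L[ℝ] TangentSpace I q :=
  (trivializationAt E (TangentSpace I) q₀).symmL ℝ q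

theorem tangentCoord_tangentOfCoord {q₀ q : M} (hq : q ∈ (chartAt H q₀).source) (v : E) :
    tangentCoord (J := I) q₀ q (tangentOfCoord q₀ q v) = v :=
  Trivialization.continuousLinearMapAt_symmL _ (by simpa using hq) v

theorem tangentOfCoord_tangentCoord {q₀ q : M} (hq : q ∈ (chartAt H q₀).source)
    (v : TangentSpace I q) : tangentOfCoord q₀ q (tangentCoord q₀ q v) = v :=
  Trivialization.symmL_continuousLinearMapAt _ (by simpa using hq) v

variable (I) in
/-- The change of tangent coordinates at `q` from the chart at `q₁` to the chart at `q₀`. -/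
noncomputable def coordChange (q₁ q₀ q : M) : E →L[ℝ] E :=
  (tangentCoord (J := I) q₀ q).comp (tangentOfCoord q₁ q)

theorem coordChange_tangentCoord {q₁ q₀ q : M} (hq : q ∈ (chartAt H q₁).source)
    (v : TangentSpace I q) : coordChange I q₁ q₀ q (tangentCoord q₁ q v) = tangentCoord q₀ q v := by
  simp [coordChange, tangentOfCoord_tangentCoord hq]

variable (I) in
theorem contMDiffAt_coordChange {q₁ q₀ q : M} (hq₁ : q ∈ (chartAt H q₁).source)
    (hq₀ : q ∈ (chartAt H q₀).source) :
    ContMDiffAt I 𝓘(ℝ, E →L[ℝ] E) ∞ (coordChange I q₁ q₀) q := by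
  have h := contMDiffAt_coordChangeL (IB := I) (n := ∞)
    (e := trivializationAt E (TangentSpace I) q₁)
    (e' := trivializationAt E (TangentSpace I) q₀) (x := q)
    (by simpa using hq₁) (by simpa using hq₀)
  refine h.congr_of_eventuallyEq ?_
  filter_upwards [(chartAt H q₁).open_source.mem_nhds hq₁,
    (chartAt H q₀).open_source.mem_nhds hq₀] with q' h1 h0
  ext v
  have h0' : q' ∈ (trivializationAt E (TangentSpace I) q₀).baseSet := by simpa using h0
  have h1' : q' ∈ (trivializationAt E (TangentSpace I) q₁).baseSet := by simpa using h1
  simp [coordChange, tangentCoord, tangentOfCoord, Trivialization.coordChangeL_apply _ _ ⟨h1', h0'⟩,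
    Trivialization.continuousLinearMapAt_apply, Trivialization.coe_linearMapAt_of_mem _ h0']
  rw [Trivialization.symmL_apply _ h1']

theorem fiberCoord_eventuallyEq {q₁ q₀ : M} {p : TangentBundle I M}
    (hq₁ : p.proj ∈ (chartAt H q₁).source) :
    fiberCoord q₀ =ᶠ[nhds p] fun p' ↦ coordChange I q₁ q₀ p'.proj (fiberCoord q₁ p') := by
  filter_upwards [((chartAt H q₁).open_source.preimage
      (FiberBundle.continuous_proj E (TangentSpace I))).mem_nhds hq₁] with p' hp'
  exact (coordChange_tangentCoord hp' _).symm

theorem hasMFDerivAt_proj (p : TangentBundle I M) :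
    HasMFDerivAt I.tangent I (TotalSpace.proj : TangentBundle I M → M) p
      (mfderiv I.tangent I (TotalSpace.proj : TangentBundle I M → M) p) :=
  ((contMDiff_proj (TangentSpace I)).contMDiffAt.mdifferentiableAt (n := ∞) (by simp)).hasMFDerivAt

theorem HasMFDerivAt.clm_apply_vector {E₁ F G : Type*} [NormedAddCommGroup E₁] [NormedSpace ℝ E₁]
    {H₁ : Type*} [TopologicalSpace H₁] {I₁ : ModelWithCorners ℝ E₁ H₁}
    {M₁ : Type*} [TopologicalSpace M₁] [ChartedSpace H₁ M₁]
    [NormedAddCommGroup F] [NormedSpace ℝ F]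
    [NormedAddCommGroup G] [NormedSpace ℝ G] {c : M₁ → F →L[ℝ] G} {u : M₁ → F} {p : M₁}
    {c' : TangentSpace I₁ p →L[ℝ] F →L[ℝ] G} {u' : TangentSpace I₁ p →L[ℝ] F}
    (hc : HasMFDerivAt I₁ 𝓘(ℝ, F →L[ℝ] G) c p c') (hu : HasMFDerivAt I₁ 𝓘(ℝ, F) u p u') :
    ∃ D : TangentSpace I₁ p →L[ℝ] G, HasMFDerivAt I₁ 𝓘(ℝ, G) (fun q ↦ c q (u q)) p D ∧
      ∀ v, D v = c p (u' v) + c' v (u p) := by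
  have h := ((isBoundedBilinearMap_apply (𝕜 := ℝ) (E := F) (F := G)).hasFDerivAt
    (c p, u p)).comp_hasMFDerivAt (f := fun q ↦ (c q, u q)) (p := p)
    ⟨hc.1.prodMk hu.1, hc.2.prodMk hu.2⟩
  exact ⟨_, h, fun v ↦ rfl⟩

/-- The product rule applied to `v₀ = C(x) v₁`; the derivative of `C` gives the off-diagonal block.
-/
theorem tangentCoord_change {p₁ p₀ p : TangentBundle I M}
    (hp₁ : p.proj ∈ (chartAt H p₁.proj).source) (hp₀ : p.proj ∈ (chartAt H p₀.proj).source)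
    (ξ : TangentSpace I.tangent p) :
    tangentCoord p₀ p ξ = (coordChange I p₁.proj p₀.proj p.proj (tangentCoord p₁ p ξ).1,
      coordChange I p₁.proj p₀.proj p.proj (tangentCoord p₁ p ξ).2 +
      mvfderiv I (coordChange I p₁.proj p₀.proj) p.proj
        (tangentOfCoord p₁.proj p.proj (tangentCoord p₁ p ξ).1) (fiberCoord p₁.proj p)) := by
  rw [tangentCoord_tangentBundle hp₀, tangentCoord_tangentBundle hp₁,
    (fiberCoord_eventuallyEq hp₁).mvfderiv_eq]
  have hC := ((contMDiffAt_coordChange I hp₁ hp₀).mdifferentiableAt (by simp)).hasMFDerivAt_mvfderiv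
  obtain ⟨D, hD, hDv⟩ := HasMFDerivAt.clm_apply_vector (hC.comp p (hasMFDerivAt_proj p))
    (hasMFDerivAt_fiberCoord hp₁)
  ext1
  · exact (coordChange_tangentCoord hp₁ _).symm
  · simp only [tangentOfCoord_tangentCoord hp₁]
    exact (DFunLike.congr_fun hD.mvfderiv_eq ξ).trans (hDv ξ)

end FrameChange

local notation "ℰ" n => EuclideanSpace ℝ (Fin n)

/-! ### The metric volume form in a fixed chart -/

section MetricVolume

variable {n : ℕ} {Q : Type*} [TopologicalSpace Q] [ChartedSpace (EuclideanSpace ℝ (Fin n)) Q]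
  [IsManifold (𝓡 n) ∞ Q]

theorem coordField_apply {q₀ q : Q} (hq : q ∈ (chartAt (ℰ n) q₀).source) (i : Fin n) :
    coordField q₀ i q = tangentOfCoord q₀ q (stdBasis n i) := by
  have hq' : q ∈ (trivializationAt (ℰ n) (TangentSpace (𝓡 n)) q₀).baseSet := by simpa using hq
  rw [coordField, Trivialization.localFrame_apply_of_mem_baseSet _ _ hq', Trivialization.basisAt,
    tangentOfCoord, Trivialization.symmL_apply _ hq']
  rfl

theorem coordBasis_apply (q : Q) (i : Fin n) :
    coordBasis q i = tangentOfCoord q q (stdBasis n i) := by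
  rw [← coordField_apply (mem_chart_source _ q), coordField,
    Trivialization.localFrame_apply_of_mem_baseSet _ _
      (FiberBundle.mem_baseSet_trivializationAt' q)]
  rfl

theorem coordBasis_repr (q : Q) (v : TangentSpace (𝓡 n) q) :
    (coordBasis q).repr v = (stdBasis n).repr (tangentCoord q q v) := by
  have h : coordBasis q = (stdBasis n).map (ContinuousLinearEquiv.equivOfInverse
      (tangentOfCoord q q) (tangentCoord q q) (tangentCoord_tangentOfCoord (mem_chart_source _ q))
      (tangentOfCoord_tangentCoord (mem_chart_source _ q))).toLinearEquiv := by
    ext i : 1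
    rw [coordBasis_apply]
    rfl
  rw [h]
  rfl

theorem tangentCoord_natBasis (p : TangentBundle (𝓡 n) Q) (i : Fin n ⊕ Fin n) :
    tangentCoord p p (natBasis p i) = (stdBasis n).prod (stdBasis n) i := by
  have hp := FiberBundle.mem_baseSet_trivializationAt' (F := (ℰ n) × (ℰ n))
    (E := (TangentSpace (𝓡 n).tangent : TangentBundle (𝓡 n) Q → Type _)) p
  rw [natBasis, Trivialization.basisAt, tangentCoord]
  have h := Trivialization.continuousLinearMapAt_symmL (R := ℝ) _ hp
    ((stdBasis n).prod (stdBasis n) i)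
  rw [Trivialization.symmL_apply _ hp] at h
  exact h

theorem natBasis_det (p : TangentBundle (𝓡 n) Q)
    (Y : Fin n ⊕ Fin n → TangentSpace (𝓡 n).tangent p) :
    (natBasis p).det Y = ((stdBasis n).prod (stdBasis n)).det (fun i ↦ tangentCoord p p (Y i)) := by
  have h := Module.Basis.det_map_linearMap (natBasis p) ((stdBasis n).prod (stdBasis n))
    (tangentCoord p p).toLinearMap Y
  have h1 : (LinearMap.toMatrix (natBasis p) ((stdBasis n).prod (stdBasis n)))
     (tangentCoord p p).toLinearMap = 1 := by
    ext i j
    rw [LinearMap.toMatrix_apply, ContinuousLinearMap.coe_coe, tangentCoord_natBasis,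
      Module.Basis.repr_self, Matrix.one_apply, Finsupp.single_apply]
    simp [eq_comm]
  rw [h1, Matrix.det_one, one_mul] at h
  exact h.symm

/-- The map is block lower triangular with `C` twice on the diagonal, so `B` does not matter. -/
theorem det_prod_triangular (C B : (ℰ n) →ₗ[ℝ] (ℰ n)) (Y : Fin n ⊕ Fin n → (ℰ n) × (ℰ n)) :
    ((stdBasis n).prod (stdBasis n)).det (fun i ↦ (C (Y i).1, C (Y i).2 + B (Y i).1)) =
      (LinearMap.toMatrix (stdBasis n) (stdBasis n) C).det ^ 2 *
        ((stdBasis n).prod (stdBasis n)).det Y := by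
  let T : ((ℰ n) × (ℰ n)) →ₗ[ℝ] ((ℰ n) × (ℰ n)) :=
    (C ∘ₗ LinearMap.fst ℝ _ _).prod (C ∘ₗ LinearMap.snd ℝ _ _ + B ∘ₗ LinearMap.fst ℝ _ _)
  have hT : LinearMap.toMatrix ((stdBasis n).prod (stdBasis n)) ((stdBasis n).prod (stdBasis n)) T =
      Matrix.fromBlocks (LinearMap.toMatrix (stdBasis n) (stdBasis n) C) 0
        (LinearMap.toMatrix (stdBasis n) (stdBasis n) B)
        (LinearMap.toMatrix (stdBasis n) (stdBasis n) C) := by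
    ext (i | i) (j | j) <;> simp [T, LinearMap.toMatrix_apply]
  have h := Module.Basis.det_map_linearMap ((stdBasis n).prod (stdBasis n))
    ((stdBasis n).prod (stdBasis n)) T Y
  rw [hT, Matrix.det_fromBlocks_zero₁₂, ← sq] at h
  exact h

theorem contMDiffAt_coordField {q₀ q : Q} (hq : q ∈ (chartAt (ℰ n) q₀).source) (i : Fin n) :
    ContMDiffAt (𝓡 n) (𝓡 n).tangent ∞
      (fun q ↦ (⟨q, coordField q₀ i q⟩ : TangentBundle (𝓡 n) Q)) q :=
  contMDiffAt_localFrame_of_mem ∞ (trivializationAt (ℰ n) (TangentSpace (𝓡 n)) q₀) (stdBasis n) i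
    (by simpa using hq)

theorem mdifferentiableAt_coordField {q₀ q : Q} (hq : q ∈ (chartAt (ℰ n) q₀).source) (i : Fin n) :
    MDifferentiableAt (𝓡 n) (𝓡 n).tangent
      (fun q ↦ (⟨q, coordField q₀ i q⟩ : TangentBundle (𝓡 n) Q)) q :=
  (contMDiffAt_coordField hq i).mdifferentiableAt (by simp)

variable [RiemannianBundle (fun q : Q ↦ TangentSpace (𝓡 n) q)]

/-- The matrix `gᵢⱼ` at `q`, in the preferred chart at `q₀`. -/
noncomputable def metricMatrix (q₀ q : Q) : Matrix (Fin n) (Fin n) ℝ :=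
  Matrix.of fun i j ↦ inner ℝ (coordField q₀ i q) (coordField q₀ j q)

theorem metricDet_eq (q : Q) : metricDet (n := n) q = (metricMatrix (n := n) q q).det := by
  simp only [metricDet, metricMatrix, coordBasis_apply, coordField_apply (mem_chart_source _ q)]

theorem metricMatrix_change {q₁ q₀ q : Q} (hq₁ : q ∈ (chartAt (ℰ n) q₁).source)
    (hq₀ : q ∈ (chartAt (ℰ n) q₀).source) :
    (metricMatrix (n := n) q₁ q).det = (LinearMap.toMatrix (stdBasis n) (stdBasis n)
      (coordChange (𝓡 n) q₁ q₀ q).toLinearMap).det ^ 2 * (metricMatrix (n := n) q₀ q).det := by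
  set C := LinearMap.toMatrix (stdBasis n) (stdBasis n) (coordChange (𝓡 n) q₁ q₀ q).toLinearMap
    with hC
  have h (i : Fin n) : coordField q₁ i q = ∑ j, C j i • coordField q₀ j q := by
    simp only [coordField_apply hq₁, coordField_apply hq₀, ← map_smul, ← map_sum]
    rw [← tangentOfCoord_tangentCoord hq₀ (tangentOfCoord q₁ q (stdBasis n i))]
    congr 1
    simp only [hC, LinearMap.toMatrix_apply]
    exact ((stdBasis n).sum_repr _).symm
  have : metricMatrix (n := n) q₁ q = C.transpose * metricMatrix (n := n) q₀ q * C := by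
    ext i j
    simp only [metricMatrix, Matrix.of_apply, h, sum_inner, inner_sum, real_inner_smul_left,
      real_inner_smul_right, Matrix.mul_apply, Matrix.transpose_apply, Finset.sum_mul]
    refine Finset.sum_congr rfl fun k _ ↦ Finset.sum_congr rfl fun l _ ↦ by ring
  rw [this, Matrix.det_mul, Matrix.det_mul, Matrix.det_transpose]
  ring

/-- The factor `(det C)²` from `metricMatrix_change` is absorbed by the one from
`det_prod_triangular`. -/
theorem metricVolume_apply {p₀ p : TangentBundle (𝓡 n) Q}
    (hp : p.proj ∈ (chartAt (ℰ n) p₀.proj).source)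
    (Y : Fin n ⊕ Fin n → TangentSpace (𝓡 n).tangent p) :
    metricVolume p Y = (metricMatrix (n := n) p₀.proj p.proj).det *
      ((stdBasis n).prod (stdBasis n)).det (fun i ↦ tangentCoord p₀ p (Y i)) := by
  have hpp := mem_chart_source (ℰ n) p.proj
  rw [metricVolume, AlternatingMap.smul_apply, natBasis_det, metricDet_eq, smul_eq_mul,
    metricMatrix_change hpp hp]
  simp only [tangentCoord_change hpp hp]
  have := det_prod_triangular (coordChange (𝓡 n) p.proj p₀.proj p.proj).toLinearMap
    ((ContinuousLinearMap.apply ℝ (ℰ n) (fiberCoord p.proj p)).toLinearMap ∘ₗ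
      (mvfderiv (𝓡 n) (coordChange (𝓡 n) p.proj p₀.proj) p.proj).toLinearMap ∘ₗ
      (tangentOfCoord p.proj p.proj).toLinearMap) (fun i ↦ tangentCoord p p (Y i))
  have h2 := this.symm
  simp only [ContinuousLinearMap.coe_coe, LinearMap.comp_apply,
    ContinuousLinearMap.apply_apply] at h2
  rw [← h2]
  ring

theorem metricMatrix_det_pos {q₀ q : Q} (hq : q ∈ (chartAt (ℰ n) q₀).source) :
    0 < (metricMatrix (n := n) q₀ q).det := by
  have h : LinearIndependent ℝ (fun i ↦ coordField (n := n) q₀ i q) := by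
    refine LinearIndependent.of_comp (tangentCoord q₀ q).toLinearMap ?_
    have e : (tangentCoord q₀ q).toLinearMap ∘ (fun i ↦ coordField (n := n) q₀ i q) =
        stdBasis n := by
      ext1 i
      simp [coordField_apply hq, tangentCoord_tangentOfCoord hq]
    rw [e]
    exact (stdBasis n).linearIndependent
  exact (Matrix.posDef_gram_of_linearIndependent h).det_pos

theorem contMDiffAt_metricMatrix_det [IsContMDiffRiemannianBundle (𝓡 n) ∞ (ℰ n)
      (fun q : Q ↦ TangentSpace (𝓡 n) q)] {q₀ q : Q} (hq : q ∈ (chartAt (ℰ n) q₀).source) :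
    ContMDiffAt (𝓡 n) 𝓘(ℝ, ℝ) ∞ (fun q ↦ (metricMatrix (n := n) q₀ q).det) q := by
  simp only [Matrix.det_apply']
  exact ContMDiffAt.sum fun σ _ ↦ contMDiffAt_const.mul <| contMDiffAt_finsetProd fun i _ ↦
    (contMDiffAt_coordField hq _).inner_bundle (contMDiffAt_coordField hq _)

end MetricVolume

/-! ### The geodesic spray in a fixed chart -/

section Spray

variable {n : ℕ} {Q : Type*} [TopologicalSpace Q] [ChartedSpace (EuclideanSpace ℝ (Fin n)) Q]
  [IsManifold (𝓡 n) ∞ Q]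
  (cov : CovariantDerivative (𝓡 n) (EuclideanSpace ℝ (Fin n)) (TangentSpace (𝓡 n) : Q → Type _))

/-- The map `a ↦ ∇_a ∂/∂xᵏ` at `q`, in the coordinates of the preferred chart at `q₀`. -/
noncomputable def christoffelMap (q₀ q : Q) (k : Fin n) : (ℰ n) →L[ℝ] (ℰ n) :=
  (tangentCoord q₀ q).comp ((cov (coordField q₀ k) q).comp (tangentOfCoord q₀ q))

/-- Differentiability of the partial sum is carried along because additivity of `cov` needs it in
the induction. -/
theorem CovariantDerivative.map_sum {ι : Type*} (s : Finset ι)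
    {X : ι → ∀ q : Q, TangentSpace (𝓡 n) q} {q : Q}
    (hX : ∀ i, MDifferentiableAt (𝓡 n) (𝓡 n).tangent
      (fun q ↦ (⟨q, X i q⟩ : TangentBundle (𝓡 n) Q)) q) :
    cov (∑ i ∈ s, X i) q = ∑ i ∈ s, cov (X i) q ∧
    MDifferentiableAt (𝓡 n) (𝓡 n).tangent
      (fun q ↦ (⟨q, (∑ i ∈ s, X i) q⟩ : TangentBundle (𝓡 n) Q)) q := by
  classical
  induction s using Finset.induction_on with
  | empty =>
    refine ⟨by simp, ?_⟩
    exact mdifferentiableAt_zeroSection ℝ (TangentSpace (𝓡 n))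
  | insert a s ha ih =>
    rw [Finset.sum_insert ha, Finset.sum_insert ha, ← ih.1]
    refine ⟨cov.isCovariantDerivativeOnUniv.add (hX a) ih.2, ?_⟩
    exact mdifferentiableAt_add_section (hX a) ih.2

/-- The Leibniz rule in coordinates. -/
theorem cov_tangentOfCoord {q₀ q : Q} (hq : q ∈ (chartAt (ℰ n) q₀).source)
    {X : ∀ q : Q, TangentSpace (𝓡 n) q} {u : Q → (ℰ n)}
    (hX : MDifferentiableAt (𝓡 n) (𝓡 n).tangent (fun q ↦ (⟨q, X q⟩ : TangentBundle (𝓡 n) Q)) q)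
    (hu : MDifferentiableAt (𝓡 n) 𝓘(ℝ, ℰ n) u q)
    (hXu : ∀ᶠ q' in nhds q, X q' = tangentOfCoord q₀ q' (u q')) (w : TangentSpace (𝓡 n) q) :
    tangentCoord q₀ q (cov X q w) =
      mvfderiv (𝓡 n) u q w + ∑ k, u q k • christoffelMap cov q₀ q k (tangentCoord q₀ q w) := by
  have hui (k : Fin n) : HasMFDerivAt (𝓡 n) 𝓘(ℝ, ℝ) (fun q' ↦ u q' k) q
      ((EuclideanSpace.proj k).comp (mvfderiv (𝓡 n) u q)) :=
    (EuclideanSpace.proj (𝕜 := ℝ) k).hasFDerivAt.comp_hasMFDerivAt hu.hasMFDerivAt_mvfderiv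
  have hd (k : Fin n) : MDifferentiableAt (𝓡 n) (𝓡 n).tangent
      (fun q' ↦ (⟨q', ((fun q' ↦ u q' k) • coordField q₀ k) q'⟩ : TangentBundle (𝓡 n) Q)) q :=
    (hui k).mdifferentiableAt.smul_section (mdifferentiableAt_coordField hq k)
  have hs := CovariantDerivative.map_sum cov Finset.univ hd
  have he : ∀ᶠ q' in nhds q, X q' = (∑ k, (fun q' ↦ u q' k) • coordField q₀ k) q' := by
    filter_upwards [hXu, (chartAt (ℰ n) q₀).open_source.mem_nhds hq] with q' h1 h2
    rw [h1, Finset.sum_apply]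
    simp only [Pi.smul_apply', coordField_apply h2, ← map_smul, ← _root_.map_sum]
    congr 1
    exact ((stdBasis n).sum_repr _).symm
  rw [cov.isCovariantDerivativeOnUniv.congr_of_eventuallyEq hX hs.2 Filter.univ_mem he, hs.1]
  have hk (k : Fin n) := cov.isCovariantDerivativeOnUniv.leibniz (mdifferentiableAt_coordField hq k)
    (hui k).mdifferentiableAt
  have ht : tangentOfCoord q₀ q (tangentCoord q₀ q w) = w := tangentOfCoord_tangentCoord hq w
  simp only [hk, (hui _).mvfderiv_eq, sum_apply, add_apply, smul_apply,
    ContinuousLinearMap.smulRight_apply, map_add, map_smul, _root_.map_sum, christoffelMap,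
    ContinuousLinearMap.comp_apply, ht, coordField_apply hq, tangentCoord_tangentOfCoord hq,
    Finset.sum_add_distrib]
  rw [add_comm]
  congr 1
  exact (stdBasis n).sum_repr (mvfderiv (𝓡 n) u q w)

/-- The quadratic term `Γⁱⱼₖ vʲ vᵏ` of the geodesic equation at `q`, in the coordinates of the
preferred chart at `q₀`. -/
noncomputable def sprayCoeff (q₀ q : Q) (v : ℰ n) : ℰ n :=
  ∑ k, v k • christoffelMap cov q₀ q k v

theorem mdifferentiableAt_tangentOfCoord {q₀ q : Q} (hq : q ∈ (chartAt (ℰ n) q₀).source) (v : ℰ n) :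
    MDifferentiableAt (𝓡 n) (𝓡 n).tangent
      (fun q ↦ (⟨q, tangentOfCoord q₀ q v⟩ : TangentBundle (𝓡 n) Q)) q := by
  have hq' : q ∈ (trivializationAt (ℰ n) (TangentSpace (𝓡 n)) q₀).baseSet := by simpa using hq
  refine ((Trivialization.contMDiffAt_section_iff _ (n := 1) hq').2 ?_).mdifferentiableAt (by simp)
  refine (contMDiffAt_const (c := v)).congr_of_eventuallyEq ?_
  filter_upwards [(chartAt (ℰ n) q₀).open_source.mem_nhds hq] with q' h
  rw [trivializationAt_snd h, tangentCoord_tangentOfCoord h]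

/-- The transformation law of the Christoffel symbols: take the field with constant coordinates `v`
in the chart at `q₁`, and compute its covariant derivative along itself in both charts. -/
theorem coordChange_sprayCoeff {q₁ q₀ q : Q} (hq₁ : q ∈ (chartAt (ℰ n) q₁).source)
    (hq₀ : q ∈ (chartAt (ℰ n) q₀).source) (v : ℰ n) :
    coordChange (𝓡 n) q₁ q₀ q (sprayCoeff cov q₁ q v) =
      mvfderiv (𝓡 n) (coordChange (𝓡 n) q₁ q₀) q (tangentOfCoord q₁ q v) v +
        sprayCoeff cov q₀ q (coordChange (𝓡 n) q₁ q₀ q v) := by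
  have hX := mdifferentiableAt_tangentOfCoord hq₁ v
  have h1 := cov_tangentOfCoord cov hq₁ hX (mdifferentiableAt_const (c := v))
    (Filter.Eventually.of_forall fun q' ↦ rfl) (tangentOfCoord q₁ q v)
  have hC := ((contMDiffAt_coordChange (𝓡 n) hq₁ hq₀).mdifferentiableAt
    (by simp)).hasMFDerivAt_mvfderiv
  have hv : HasMFDerivAt (𝓡 n) 𝓘(ℝ, ℰ n) (fun _ : Q ↦ v) q
      (0 : TangentSpace (𝓡 n) q →L[ℝ] (ℰ n)) := hasMFDerivAt_const v q
  obtain ⟨D, hD, hDv⟩ := hC.clm_apply_vector hv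
  have h0 := cov_tangentOfCoord cov hq₀ hX hD.mdifferentiableAt (by
    filter_upwards [(chartAt (ℰ n) q₀).open_source.mem_nhds hq₀] with q' h
    exact (tangentOfCoord_tangentCoord h _).symm) (tangentOfCoord q₁ q v)
  rw [hD.mvfderiv_eq, hDv] at h0
  simp only [mvfderiv_const, tangentCoord_tangentOfCoord hq₁, zero_apply,
    zero_add, map_zero] at h1 h0
  rw [sprayCoeff, ← h1, coordChange_tangentCoord hq₁, h0]
  rfl

theorem tangentCoord_geodesicSpray_self (p : TangentBundle (𝓡 n) Q) :
    tangentCoord p p (geodesicSpray cov p) =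
      (fiberCoord p.proj p, -sprayCoeff cov p.proj p.proj (fiberCoord p.proj p)) := by
  have hq := mem_chart_source (ℰ n) p.proj
  set v := fiberCoord p.proj p with hv
  have hvi (i : Fin n) : (coordBasis p.proj).repr p.snd i = v i := by
    rw [coordBasis_repr]
    rfl
  have hΓ (i j k : Fin n) : christoffel cov p.proj i j k =
      christoffelMap cov p.proj p.proj k (stdBasis n j) i := by
    rw [christoffel, coordBasis_repr, coordField_apply hq j]
    rfl
  have hsum (u : ℰ n) : ∑ i, u i • stdBasis n i = u := (stdBasis n).sum_repr u
  have hcoef : ∑ i, (∑ j, ∑ k, christoffel cov p.proj i j k * v j * v k) • stdBasis n i =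
      sprayCoeff cov p.proj p.proj v := by
    rw [← hsum (sprayCoeff cov p.proj p.proj v)]
    refine Finset.sum_congr rfl fun i _ ↦ ?_
    congr 1
    rw [Finset.sum_comm, sprayCoeff, WithLp.ofLp_sum, Finset.sum_apply]
    refine Finset.sum_congr rfl fun k _ ↦ ?_
    have h := congrArg (fun u ↦ (EuclideanSpace.proj (𝕜 := ℝ) i).comp
      (christoffelMap cov p.proj p.proj k) u) (hsum v)
    simp only [_root_.map_sum, map_smul, ContinuousLinearMap.comp_apply,
      smul_eq_mul] at h
    refine Eq.trans ?_ (congrArg (v k * ·) h)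
    simp only [hΓ, Finset.mul_sum]
    exact Finset.sum_congr rfl fun j _ ↦ (mul_comm _ _).trans (congrArg _ (mul_comm _ _))
  simp only [geodesicSpray, hvi, map_sub, _root_.map_sum, map_smul, tangentCoord_natBasis]
  ext1
  · simp [Prod.fst_sum, hsum]
  · simp [Prod.snd_sum, ← hcoef]

theorem tangentCoord_geodesicSpray {p₀ p : TangentBundle (𝓡 n) Q}
    (hp : p.proj ∈ (chartAt (ℰ n) p₀.proj).source) :
    tangentCoord p₀ p (geodesicSpray cov p) =
      (fiberCoord p₀.proj p, -sprayCoeff cov p₀.proj p.proj (fiberCoord p₀.proj p)) := by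
  have hpp := mem_chart_source (ℰ n) p.proj
  have hf : coordChange (𝓡 n) p.proj p₀.proj p.proj (fiberCoord p.proj p) =
    fiberCoord p₀.proj p := coordChange_tangentCoord hpp _
  rw [tangentCoord_change hpp hp, tangentCoord_geodesicSpray_self, map_neg,
    coordChange_sprayCoeff cov hpp hp, hf]
  simp

end Spray

/-! ### Smoothness and derivative of the spray -/

theorem ContinuousLinearMap.contDiff_smulRight {E F : Type*} [NormedAddCommGroup E]
    [NormedSpace ℝ E] [NormedAddCommGroup F] [NormedSpace ℝ F] {m : ℕ∞ω} (f : E →L[ℝ] ℝ) :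
    ContDiff ℝ m (fun x : F ↦ f.smulRight x) :=
  (ContinuousLinearMap.smulRightL ℝ E F f).contDiff

section SpraySmooth

variable {n : ℕ} {Q : Type*} [TopologicalSpace Q] [ChartedSpace (EuclideanSpace ℝ (Fin n)) Q]
  [IsManifold (𝓡 n) ∞ Q]
  (cov : CovariantDerivative (𝓡 n) (EuclideanSpace ℝ (Fin n)) (TangentSpace (𝓡 n) : Q → Type _))

theorem contMDiffAt_christoffelMap [T2Space Q] (hsmooth : cov.ContMDiffCovariantDerivative ∞)
    (q₀ : Q) (k : Fin n) :
    ContMDiffAt (𝓡 n) 𝓘(ℝ, (ℰ n) →L[ℝ] (ℰ n)) ∞ (fun q ↦ christoffelMap cov q₀ q k) q₀ := by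
  have hU := (chartAt (ℰ n) q₀).open_source.mem_nhds (mem_chart_source (ℰ n) q₀)
  -- Smoothness of `cov` speaks of globally smooth fields, while the coordinate field is smooth only
  -- on the chart domain. It is cut off by a bump function equal to 1 near `q₀`, which by locality
  -- leaves its covariant derivative near `q₀` unchanged.
  let ψ : SmoothBumpFunction (𝓡 n) q₀ := Classical.choice inferInstance
  have hσ : ContMDiff (𝓡 n) (𝓡 n).tangent ∞
      (fun q ↦ (⟨q, ((ψ : Q → ℝ) • coordField q₀ k) q⟩ : TangentBundle (𝓡 n) Q)) :=
    ContMDiffOn.smul_section_of_tsupport ψ.contMDiff.contMDiffOn (chartAt (ℰ n) q₀).open_source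
      ψ.tsupport_subset_chartAt_source fun q hq ↦ (contMDiffAt_coordField hq k).contMDiffWithinAt
  have h1 := (hsmooth.contMDiff.contMDiff (σ := (ψ : Q → ℝ) • coordField q₀ k)
    hσ.contMDiffOn).contMDiffAt (x := q₀) Filter.univ_mem
  have h2 := ((contMDiffAt_hom_bundle _).1 h1).2
  refine h2.congr_of_eventuallyEq ?_
  filter_upwards [ψ.eventuallyEq_one.eventually_nhds, hU] with q hq hqU
  have hc : cov.toFun ((ψ : Q → ℝ) • coordField q₀ k) q = cov.toFun (coordField q₀ k) q := by
    refine cov.isCovariantDerivativeOnUniv.congr_of_eventuallyEq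
      (hσ.contMDiffAt.mdifferentiableAt (by simp)) (mdifferentiableAt_coordField hqU k)
      Filter.univ_mem ?_
    filter_upwards [hq] with q' hq'
    simp [hq']
  rw [ContinuousLinearMap.inCoordinates, hc]
  rfl

/-- The bilinear map `(u, w) ↦ Γⁱⱼₖ wʲ uᵏ` at `q`, in the coordinates of the preferred chart at
`q₀`. -/
noncomputable def christoffelBilin (q₀ q : Q) : (ℰ n) →L[ℝ] (ℰ n) →L[ℝ] (ℰ n) :=
  ∑ k, (EuclideanSpace.proj k).smulRight (christoffelMap cov q₀ q k)

theorem sprayCoeff_eq (q₀ q : Q) (v : ℰ n) :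
    sprayCoeff cov q₀ q v = christoffelBilin cov q₀ q v v := by
  simp [sprayCoeff, christoffelBilin]

theorem christoffelBilin_stdBasis (q₀ q : Q) (k : Fin n) :
    christoffelBilin cov q₀ q (stdBasis n k) = christoffelMap cov q₀ q k := by
  simp [christoffelBilin, stdBasis]

theorem contMDiffAt_christoffelBilin [T2Space Q] (hsmooth : cov.ContMDiffCovariantDerivative ∞)
    (q₀ : Q) : ContMDiffAt (𝓡 n) 𝓘(ℝ, (ℰ n) →L[ℝ] (ℰ n) →L[ℝ] (ℰ n)) ∞
      (fun q ↦ christoffelBilin cov q₀ q) q₀ := by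
  refine ContMDiffAt.sum fun k _ ↦ ?_
  exact (ContinuousLinearMap.contDiff_smulRight (EuclideanSpace.proj k)).contMDiff.contMDiffAt.comp
    q₀ (contMDiffAt_christoffelMap cov hsmooth q₀ k)

theorem tangentCoord_geodesicSpray_eventuallyEq (p₀ : TangentBundle (𝓡 n) Q) :
    (fun p ↦ tangentCoord p₀ p (geodesicSpray cov p)) =ᶠ[nhds p₀] fun p ↦
      (fiberCoord p₀.proj p, -christoffelBilin cov p₀.proj p.proj (fiberCoord p₀.proj p)
        (fiberCoord p₀.proj p)) := by
  filter_upwards [((chartAt (ℰ n) p₀.proj).open_source.preimage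
    (FiberBundle.continuous_proj (ℰ n) (TangentSpace (𝓡 n)))).mem_nhds
      (mem_chart_source (ℰ n) p₀.proj)] with p hp
  rw [← sprayCoeff_eq]
  exact tangentCoord_geodesicSpray cov hp

theorem contMDiff_geodesicSpray [T2Space Q] (hsmooth : cov.ContMDiffCovariantDerivative ∞) :
    ContMDiff (𝓡 n).tangent (𝓡 n).tangent.tangent ∞
      (fun p ↦ (⟨p, geodesicSpray cov p⟩ :
        TangentBundle (𝓡 n).tangent (TangentBundle (𝓡 n) Q))) := by
  intro p₀
  rw [contMDiffAt_tangentCoord_iff]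
  have hf := contMDiffAt_fiberCoord (mem_chart_source (ℰ n) p₀.proj)
  have hB := (contMDiffAt_christoffelBilin cov hsmooth p₀.proj).comp p₀
    (contMDiff_proj (TangentSpace (𝓡 n))).contMDiffAt
  exact (hf.prodMk_space ((hB.clm_apply hf).clm_apply hf).neg).congr_of_eventuallyEq
    (tangentCoord_geodesicSpray_eventuallyEq cov p₀)

/-- Only the two diagonal blocks of the derivative are recorded, since the trace sees nothing else.
-/
theorem exists_mvfderiv_geodesicSpray [T2Space Q] (hsmooth : cov.ContMDiffCovariantDerivative ∞)
    (p₀ : TangentBundle (𝓡 n) Q) : ∃ A : ((ℰ n) × (ℰ n)) →ₗ[ℝ] ((ℰ n) × (ℰ n)),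
      (∀ ξ : TangentSpace (𝓡 n).tangent p₀, A (tangentCoord p₀ p₀ ξ) =
        mvfderiv (𝓡 n).tangent (fun p ↦ tangentCoord p₀ p (geodesicSpray cov p)) p₀ ξ) ∧
      (∀ a, (A (a, 0)).1 = 0) ∧
      (∀ b, (A (0, b)).2 = -(christoffelBilin cov p₀.proj p₀.proj b (fiberCoord p₀.proj p₀) +
        christoffelBilin cov p₀.proj p₀.proj (fiberCoord p₀.proj p₀) b)) := by
  have hq := mem_chart_source (ℰ n) p₀.proj
  have hf := hasMFDerivAt_fiberCoord hq
  have hB := ((contMDiffAt_christoffelBilin cov hsmooth p₀.proj).mdifferentiableAt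
    (by simp)).hasMFDerivAt_mvfderiv
  obtain ⟨D₁, hD₁, hDv₁⟩ := HasMFDerivAt.clm_apply_vector (hB.comp p₀ (hasMFDerivAt_proj p₀)) hf
  obtain ⟨D₂, hD₂, hDv₂⟩ := hD₁.clm_apply_vector hf
  have hG : HasMFDerivAt (𝓡 n).tangent 𝓘(ℝ, (ℰ n) × (ℰ n)) (fun p ↦
      (fiberCoord p₀.proj p, -christoffelBilin cov p₀.proj p.proj (fiberCoord p₀.proj p)
        (fiberCoord p₀.proj p))) p₀
      ((mvfderiv (𝓡 n).tangent (fiberCoord p₀.proj) p₀).prod (-D₂)) :=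
    ⟨hf.1.prodMk hD₂.1.neg, hf.2.prodMk hD₂.2.neg⟩
  have hξ (a b : ℰ n) : ∃ ξ : TangentSpace (𝓡 n).tangent p₀,
      tangentCoord p₀ p₀ ξ = (a, b) := by
    rw [tangentCoord_self]
    exact ⟨(a, b), rfl⟩
  have hA (ξ : TangentSpace (𝓡 n).tangent p₀) :
      (mvfderiv (𝓡 n).tangent (fun p ↦ tangentCoord p₀ p (geodesicSpray cov p)) p₀) ξ =
        ((tangentCoord p₀ p₀ ξ).2, -D₂ ξ) := by
    rw [(tangentCoord_geodesicSpray_eventuallyEq cov p₀).mvfderiv_eq, hG.mvfderiv_eq,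
      tangentCoord_tangentBundle hq]
    rfl
  let A : ((ℰ n) × (ℰ n)) →L[ℝ] ((ℰ n) × (ℰ n)) :=
    mvfderiv (𝓡 n).tangent (fun p ↦ tangentCoord p₀ p (geodesicSpray cov p)) p₀
  have hA' (ξ : TangentSpace (𝓡 n).tangent p₀) : A (tangentCoord p₀ p₀ ξ) =
      mvfderiv (𝓡 n).tangent (fun p ↦ tangentCoord p₀ p (geodesicSpray cov p)) p₀ ξ := by
    rw [tangentCoord_self]
    rfl
  refine ⟨A.toLinearMap, hA', fun a ↦ ?_, fun b ↦ ?_⟩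
  · obtain ⟨ξ, h⟩ := hξ a 0
    rw [← h, ContinuousLinearMap.coe_coe, hA', hA, h]
  · obtain ⟨ξ, h⟩ := hξ 0 b
    have e1 : D₁ ξ = christoffelBilin cov p₀.proj p₀.proj
        (mvfderiv (𝓡 n).tangent (fiberCoord p₀.proj) p₀ ξ) +
          (mvfderiv (𝓡 n) (fun q ↦ christoffelBilin cov p₀.proj q) p₀.proj
            (mfderiv (𝓡 n).tangent (𝓡 n) TotalSpace.proj p₀ ξ)) (fiberCoord p₀.proj p₀) :=
      hDv₁ ξ
    have e2 : D₂ ξ = christoffelBilin cov p₀.proj p₀.proj (fiberCoord p₀.proj p₀)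
        (mvfderiv (𝓡 n).tangent (fiberCoord p₀.proj) p₀ ξ) + D₁ ξ (fiberCoord p₀.proj p₀) :=
      hDv₂ ξ
    rw [← h, ContinuousLinearMap.coe_coe, hA', hA]
    rw [tangentCoord_tangentBundle hq] at h
    -- The vector `ξ` is vertical, so its projection to the base vanishes and the derivative of `Γ`
    -- drops out.
    have h1 := congrArg (tangentOfCoord (I := 𝓡 n) p₀.proj p₀.proj) (congrArg Prod.fst h)
    simp only [tangentOfCoord_tangentCoord hq, map_zero] at h1
    have h2 : mvfderiv (𝓡 n).tangent (fiberCoord p₀.proj) p₀ ξ = b := congrArg Prod.snd h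
    rw [h1, h2, map_zero, zero_apply, add_zero] at e1
    change -D₂ ξ = _
    rw [e2, e1, h2, add_comm]

theorem trace_eq_of_prod (A : ((ℰ n) × (ℰ n)) →ₗ[ℝ] ((ℰ n) × (ℰ n)))
    (h : ∀ a, (A (a, 0)).1 = 0) : LinearMap.trace ℝ _ A = ∑ i, (A (0, stdBasis n i)).2 i := by
  rw [LinearMap.trace_eq_matrix_trace ℝ ((stdBasis n).prod (stdBasis n)), Matrix.trace]
  simp [LinearMap.toMatrix_apply, h, stdBasis]

theorem trace_eq_sum (A : (ℰ n) →ₗ[ℝ] (ℰ n)) :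
   LinearMap.trace ℝ _ A = ∑ i, A (stdBasis n i) i := by
  rw [LinearMap.trace_eq_matrix_trace ℝ (stdBasis n), Matrix.trace]
  simp [LinearMap.toMatrix_apply, stdBasis]

end SpraySmooth

/-! ### Derivative of `det g`, trace of the torsion and the divergence formula -/

/-- Jacobi's formula for `M' = NᵀM + MN`, the form taken by the derivative of a compatible metric.
Row operations handle the first term; the second is the column version transposed. Each contributes
one trace. -/
theorem Matrix.sum_det_updateRow_transpose_mul_add_mul {R ι : Type*} [CommRing R] [Fintype ι]
    [DecidableEq ι] (M N : Matrix ι ι R) :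
    ∑ i, (M.updateRow i ((N.transpose * M + M * N).row i)).det = 2 * N.trace * M.det := by
  have h1 (i : ι) : (M.updateRow i ((N.transpose * M).row i)).det = N i i * M.det := by
    refine Eq.trans (congrArg (fun r ↦ (M.updateRow i r).det) ?_)
      (M.det_updateRow_sum i (fun k ↦ N k i))
    ext j
    simp [Matrix.mul_apply, Matrix.row]
  have h2 (i : ι) : (M.updateRow i ((M * N).row i)).det =
      (M.transpose.updateCol i ((N.transpose * M.transpose).col i)).det := by
    rw [← Matrix.transpose_mul, Matrix.updateCol_transpose, Matrix.det_transpose]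
    rfl
  have h3 (i : ι) : (N.transpose * M + M * N).row i = (N.transpose * M).row i + (M * N).row i := rfl
  simp only [h3, Matrix.det_updateRow_add, h1, h2, Finset.sum_add_distrib, ← Finset.sum_mul,
    Matrix.sum_det_updateCol_mul, Matrix.det_transpose, Matrix.trace_transpose]
  change N.trace * M.det + N.trace * M.det = _
  ring

section Main

variable {n : ℕ} {Q : Type*} [TopologicalSpace Q] [ChartedSpace (EuclideanSpace ℝ (Fin n)) Q]
  [IsManifold (𝓡 n) ∞ Q]
  (cov : CovariantDerivative (𝓡 n) (EuclideanSpace ℝ (Fin n)) (TangentSpace (𝓡 n) : Q → Type _))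

/-- Torsion is tensorial, so it can be evaluated on fields with constant coordinates, whose bracket
vanishes at `q`. -/
theorem torsionTrace_eq (q : Q) (v : TangentSpace (𝓡 n) q) :
    torsionTrace cov q v =
      ∑ i, (christoffelBilin cov q q (stdBasis n i) (tangentCoord q q v) i -
        christoffelBilin cov q q (tangentCoord q q v) (stdBasis n i) i) := by
  have hq := mem_chart_source (ℰ n) q
  have hc (u : ℰ n) : ∀ᶠ q' in nhds q, tangentCoord (J := 𝓡 n) q q' (tangentOfCoord q q' u) = u := by
    filter_upwards [(chartAt (ℰ n) q).open_source.mem_nhds hq] with q' h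
    exact tangentCoord_tangentOfCoord h u
  have hT (u w : ℰ n) : tangentCoord q q (cov.torsion q (tangentOfCoord q q u)
      (tangentOfCoord q q w)) = christoffelBilin cov q q w u - christoffelBilin cov q q u w := by
    have hu := mdifferentiableAt_tangentOfCoord hq u
    have hw := mdifferentiableAt_tangentOfCoord hq w
    have hcov (a b : ℰ n) : tangentCoord q q (cov (fun q' ↦ tangentOfCoord q q' a) q
        (tangentOfCoord q q b)) = christoffelBilin cov q q a b := by
      rw [cov_tangentOfCoord cov hq (mdifferentiableAt_tangentOfCoord hq a)
        (mdifferentiableAt_const (c := a)) (Filter.Eventually.of_forall fun q' ↦ rfl)]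
      simp [christoffelBilin, tangentCoord_tangentOfCoord hq, mvfderiv_const]
    have hL : tangentCoord q q (VectorField.mlieBracket (𝓡 n) (fun q' ↦ tangentOfCoord q q' u)
        (fun q' ↦ tangentOfCoord q q' w) q) = 0 := by
      rw [tangentCoord_mlieBracket hu hw, Filter.EventuallyEq.mvfderiv_eq (hc u),
        Filter.EventuallyEq.mvfderiv_eq (hc w)]
      simp [mvfderiv_const]
    rw [cov.torsion_apply hu hw, map_sub, map_sub, hL, sub_zero, hcov, hcov]
  -- The tangent space at `q` is by definition the model space, and coordinates in the chart at `q`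
  -- are the identity there, so the trace can be taken in the standard basis.
  let A : (ℰ n) →ₗ[ℝ] (ℰ n) := (cov.torsion q v).toLinearMap
  have hA (i : Fin n) : A (stdBasis n i) = christoffelBilin cov q q (stdBasis n i)
      (tangentCoord q q v) - christoffelBilin cov q q (tangentCoord q q v) (stdBasis n i) := by
    rw [← hT, tangentOfCoord_tangentCoord hq]
    have h1 : tangentOfCoord (I := 𝓡 n) q q (stdBasis n i) = (stdBasis n i : ℰ n) := by
      rw [← tangentCoord_tangentOfCoord (I := 𝓡 n) hq (stdBasis n i)]
      rw [tangentOfCoord_tangentCoord hq, tangentCoord_self]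
      rfl
    rw [h1, tangentCoord_self]
    rfl
  refine (trace_eq_sum A).trans (Finset.sum_congr rfl fun i _ ↦ ?_)
  rw [hA]
  rfl

theorem mfderiv_proj_geodesicSpray (p : TangentBundle (𝓡 n) Q) :
    mfderiv (𝓡 n).tangent (𝓡 n) (TotalSpace.proj : TangentBundle (𝓡 n) Q → Q) p
      (geodesicSpray cov p) = p.snd := by
  have hq := mem_chart_source (ℰ n) p.proj
  have h := (tangentCoord_tangentBundle hq (geodesicSpray cov p)).symm.trans
    (tangentCoord_geodesicSpray_self cov p)
  have h1 := congrArg (tangentOfCoord (I := 𝓡 n) p.proj p.proj) (congrArg Prod.fst h)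
  simp only [fiberCoord, tangentOfCoord_tangentCoord hq] at h1
  exact h1

variable [RiemannianBundle (fun q : Q ↦ TangentSpace (𝓡 n) q)]
    [IsContMDiffRiemannianBundle (𝓡 n) ∞ (EuclideanSpace ℝ (Fin n))
      (fun q : Q ↦ TangentSpace (𝓡 n) q)]

variable {cov} in
theorem CovariantDerivative.IsMetricCompatible.mvfderiv_metricMatrix_det
    (hmetric : cov.IsMetricCompatible) {q₀ q : Q} (hq : q ∈ (chartAt (ℰ n) q₀).source)
    (w : TangentSpace (𝓡 n) q) :
    mvfderiv (𝓡 n) (fun q ↦ (metricMatrix (n := n) q₀ q).det) q w =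
      2 * (∑ i, christoffelMap cov q₀ q i (tangentCoord q₀ q w) i) *
        (metricMatrix (n := n) q₀ q).det := by
  have hd (i j : Fin n) : MDifferentiableAt (𝓡 n) 𝓘(ℝ, ℝ)
      (fun q ↦ metricMatrix (n := n) q₀ q i j) q :=
    ((contMDiffAt_coordField hq i).inner_bundle (contMDiffAt_coordField hq j)).mdifferentiableAt
      (by simp)
  let N : Matrix (Fin n) (Fin n) ℝ :=
    Matrix.of fun i j ↦ christoffelMap cov q₀ q j (tangentCoord q₀ q w) i
  have hN (j : Fin n) : cov (coordField q₀ j) q w = ∑ k, N k j • coordField q₀ k q := by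
    have h : ∑ k, N k j • stdBasis n k = christoffelMap cov q₀ q j (tangentCoord q₀ q w) :=
      (stdBasis n).sum_repr _
    have h' := congrArg (fun u ↦ tangentOfCoord (I := 𝓡 n) q₀ q u) h
    simp only [_root_.map_sum, map_smul, ← coordField_apply hq, christoffelMap,
      ContinuousLinearMap.comp_apply, tangentOfCoord_tangentCoord hq] at h'
    exact h'.symm
  have hdv (i j : Fin n) : mvfderiv (𝓡 n) (fun q ↦ metricMatrix (n := n) q₀ q i j) q w =
      (N.transpose * metricMatrix (n := n) q₀ q + metricMatrix (n := n) q₀ q * N) i j := by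
    have h := hmetric.mvfderiv_inner_eq (fun q' ↦ tangentOfCoord q₀ q' (tangentCoord q₀ q w))
      (mdifferentiableAt_coordField hq i) (mdifferentiableAt_coordField hq j)
    simp only [tangentOfCoord_tangentCoord hq] at h
    refine h.trans ?_
    simp only [hN, sum_inner, inner_sum, real_inner_smul_left,
      real_inner_smul_right, Matrix.add_apply, Matrix.mul_apply, Matrix.transpose_apply,
      metricMatrix, Matrix.of_apply]
    congr 1
    exact Finset.sum_congr rfl fun k _ ↦ mul_comm _ _
  obtain ⟨D, hD, hDv⟩ := (Pi.basisFun ℝ (Fin n)).hasMFDerivAt_det (I := 𝓡 n)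
    (Y := fun i q ↦ metricMatrix (n := n) q₀ q i) (p := q)
    fun i ↦ hasMFDerivAt_pi fun j ↦ (hd i j).hasMFDerivAt_mvfderiv
  have hdet (Y : Fin n → Fin n → ℝ) : (Pi.basisFun ℝ (Fin n)).det Y = (Matrix.of Y).det := by
    rw [Pi.basisFun_det]
    rfl
  have hD' : mvfderiv (𝓡 n) (fun q ↦ (metricMatrix (n := n) q₀ q).det) q = D :=
    (hD.congr_of_eventuallyEq (.of_forall fun q ↦ (hdet _).symm)).mvfderiv_eq
  simp only [hdet] at hDv
  refine (DFunLike.congr_fun hD' w).trans ((hDv w).trans ?_)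
  rw [show (∑ i, christoffelMap cov q₀ q i (tangentCoord q₀ q w) i) = N.trace from rfl,
    ← Matrix.sum_det_updateRow_transpose_mul_add_mul]
  refine Finset.sum_congr rfl fun i _ ↦ ?_
  have hrow : ContinuousLinearMap.pi (fun j ↦ mvfderiv (𝓡 n)
      (fun q ↦ metricMatrix (n := n) q₀ q i j) q) w =
      (N.transpose * metricMatrix (n := n) q₀ q + metricMatrix (n := n) q₀ q * N) i := by
    ext j
    exact hdv i j
  rw [hrow]
  rfl

theorem hasDivergence_smul_metricVolume [T2Space Q] (hsmooth : cov.ContMDiffCovariantDerivative ∞)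
    (hmetric : cov.IsMetricCompatible) {f : Q → ℝ} (hf : ContMDiff (𝓡 n) 𝓘(ℝ, ℝ) ∞ f)
    (hf₀ : ∀ q, f q ≠ 0) :
    HasDivergence (𝓡 n).tangent (fun p : TangentBundle (𝓡 n) Q ↦ f p.proj • metricVolume p)
      (geodesicSpray cov)
      (fun p ↦ mvfderiv (𝓡 n) f p.proj p.snd / f p.proj + torsionTrace cov p.proj p.snd) := by
  choose A hA hA₁ hA₂ using exists_mvfderiv_geodesicSpray cov hsmooth
  have hρ (q₀ : Q) : ContMDiffAt (𝓡 n) 𝓘(ℝ, ℝ) ∞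
      (fun q ↦ f q * (metricMatrix (n := n) q₀ q).det) q₀ :=
    hf.contMDiffAt.mul (contMDiffAt_metricMatrix_det (mem_chart_source (ℰ n) q₀))
  refine hasDivergence_of_coord ((stdBasis n).prod (stdBasis n))
    (ρ := fun p₀ p ↦ f p.proj * (metricMatrix (n := n) p₀.proj p.proj).det)
    (fun p₀ ↦ ?_) (fun p₀ ↦ ?_) (fun p ↦ ?_) (contMDiff_geodesicSpray cov hsmooth) hA
    (fun p ↦ ?_)
  · filter_upwards [((chartAt (ℰ n) p₀.proj).open_source.preimage
      (FiberBundle.continuous_proj (ℰ n) (TangentSpace (𝓡 n)))).mem_nhds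
        (mem_chart_source (ℰ n) p₀.proj)] with p hp Y
    rw [AlternatingMap.smul_apply, metricVolume_apply hp, smul_eq_mul, mul_assoc]
  · exact (hρ p₀.proj).comp p₀ (contMDiff_proj (TangentSpace (𝓡 n))).contMDiffAt
  · exact mul_ne_zero (hf₀ _) (metricMatrix_det_pos (mem_chart_source _ _)).ne'
  · have hq := mem_chart_source (ℰ n) p.proj
    have hfd := (hf.contMDiffAt (x := p.proj)).mdifferentiableAt (by simp)
    have hgd := (contMDiffAt_metricMatrix_det (n := n) hq).mdifferentiableAt (by simp)
    have h1 := (((hρ p.proj).mdifferentiableAt (by simp)).hasMFDerivAt_mvfderiv.comp p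
      (hasMFDerivAt_proj p)).mvfderiv_eq
    have h2 : mvfderiv (𝓡 n).tangent (fun p' : TangentBundle (𝓡 n) Q ↦
        f p'.proj * (metricMatrix (n := n) p.proj p'.proj).det) p (geodesicSpray cov p) =
        mvfderiv (𝓡 n) (fun q ↦ f q * (metricMatrix (n := n) p.proj q).det) p.proj p.snd := by
      rw [← mfderiv_proj_geodesicSpray cov p]
      exact DFunLike.congr_fun h1 (geodesicSpray cov p)
    have h3 : mvfderiv (𝓡 n) (fun q ↦ f q * (metricMatrix (n := n) p.proj q).det) p.proj p.snd =
        f p.proj * mvfderiv (𝓡 n) (fun q ↦ (metricMatrix (n := n) p.proj q).det) p.proj p.snd +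
        (metricMatrix (n := n) p.proj p.proj).det * mvfderiv (𝓡 n) f p.proj p.snd := by
      have := (hfd.hasMFDerivAt_mvfderiv.mul hgd.hasMFDerivAt_mvfderiv).mvfderiv_eq
      exact DFunLike.congr_fun this p.snd
    -- The cancellation: `2 Γⁱⱼᵢ vʲ` from `det g` minus `(Γⁱⱼᵢ + Γⁱᵢⱼ) vʲ` from the trace leaves the
    -- torsion.
    rw [h2, h3, hmetric.mvfderiv_metricMatrix_det hq, trace_eq_of_prod _ (hA₁ p), torsionTrace_eq]
    simp only [hA₂, ← christoffelBilin_stdBasis, Finset.sum_sub_distrib]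
    have h4 := hf₀ p.proj
    have h5 : ∑ i, (-(christoffelBilin cov p.proj p.proj (stdBasis n i) (fiberCoord p.proj p) +
        christoffelBilin cov p.proj p.proj (fiberCoord p.proj p) (stdBasis n i)) : ℰ n) i =
        -(∑ i, christoffelBilin cov p.proj p.proj (stdBasis n i)
          (tangentCoord p.proj p.proj p.snd) i
        + ∑ i, christoffelBilin cov p.proj p.proj (tangentCoord p.proj p.proj p.snd)
          (stdBasis n i) i) := by
      rw [← Finset.sum_add_distrib, ← Finset.sum_neg_distrib]
      rfl
    rw [h5]
    field_simp
    ring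

end Main

theorem mainTheorem4 {n : ℕ} {Q : Type*} [TopologicalSpace Q] [T2Space Q]
    [SecondCountableTopology Q] [ChartedSpace (EuclideanSpace ℝ (Fin n)) Q]
    [IsManifold (𝓡 n) ∞ Q]
    [RiemannianBundle (fun q : Q ↦ TangentSpace (𝓡 n) q)]
    [IsContMDiffRiemannianBundle (𝓡 n) ∞ (EuclideanSpace ℝ (Fin n))
      (fun q : Q ↦ TangentSpace (𝓡 n) q)]
    (cov : CovariantDerivative (𝓡 n) (EuclideanSpace ℝ (Fin n)) (TangentSpace (𝓡 n) : Q → Type _))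
    (hsmooth : cov.ContMDiffCovariantDerivative ∞)
    (hmetric : cov.IsMetricCompatible) :
    HasDivergence (𝓡 n).tangent (metricVolume (Q := Q)) (geodesicSpray cov)
        (fun p ↦ torsionTrace cov p.proj p.snd) ∧
      ((∃ f : Q → ℝ, IsInvariantDensity cov f) ↔ IsExactOneForm (torsionTrace cov)) := by
  have hcomp {f : Q → ℝ} (hf : ContMDiff (𝓡 n) 𝓘(ℝ, ℝ) ∞ f) {φ : ℝ → ℝ} {φ' : ℝ} {q : Q}
      (hφ : HasDerivAt φ φ' (f q)) (v : TangentSpace (𝓡 n) q) :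
      mvfderiv (𝓡 n) (fun q ↦ φ (f q)) q v = φ' * mvfderiv (𝓡 n) f q v := by
    have h := (hφ.hasFDerivAt.comp_hasMFDerivAt
      ((hf.contMDiffAt (x := q)).mdifferentiableAt (by simp)).hasMFDerivAt_mvfderiv).mvfderiv_eq
    rw [h, ContinuousLinearMap.comp_apply]
    simp [mul_comm]
  refine ⟨?_, ?_, ?_⟩
  · have h := hasDivergence_smul_metricVolume cov hsmooth hmetric (f := fun _ ↦ 1)
      contMDiff_const fun _ ↦ one_ne_zero
    simpa [mvfderiv_const] using h
  · rintro ⟨f, hf, hpos, hdiv⟩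
    -- Uniqueness of the divergence turns invariance into `df(v)/f + tr T(v) = 0`.
    have hu := (hasDivergence_smul_metricVolume cov hsmooth hmetric hf
      fun q ↦ (hpos q).ne').unique hdiv
    refine ⟨fun q ↦ -Real.log (f q), ?_, fun q v ↦ ?_⟩
    · intro q
      exact ((Real.contDiffAt_log.2 (hpos q).ne').contMDiffAt.comp q hf.contMDiffAt).neg
    · have h1 := hcomp hf (Real.hasDerivAt_log (hpos q).ne').neg v
      have h2 := hu ⟨q, v⟩
      simp only [Pi.zero_apply] at h2
      refine Eq.trans ?_ h1.symm
      field_simp at h2 ⊢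
      linarith
  · rintro ⟨h, hh, hdh⟩
    have hexp : ContMDiff (𝓡 n) 𝓘(ℝ, ℝ) ∞ (fun q ↦ Real.exp (-h q)) :=
      Real.contDiff_exp.contMDiff.comp hh.neg
    refine ⟨fun q ↦ Real.exp (-h q), hexp, fun q ↦ Real.exp_pos _, ?_⟩
    convert! hasDivergence_smul_metricVolume cov hsmooth hmetric hexp
      fun q ↦ (Real.exp_pos _).ne' using 1
    ext p
    rw [hdh, hcomp hh ((hasDerivAt_neg _).exp)]
    have := (Real.exp_pos (-h p.proj)).ne'
    simp only [Pi.zero_apply]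
    field_simp
    ring
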